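/- Let $D\subset\mathbb C^n$ be a bounded domain and let $r$ be a real-valued $C^4$ defining function for $D$: $r$ is of class $C^4$ on an open neighbourhood $U$ of $\overline D$, $D=\{z\in U: r(z)<0\}$ and $dr\neq0$ on $\partial D$. Assume that the complex Hessian $H(r)=[r_{i\overline j}]$, $r_{i\overline j}=\partial^2r/\partial z_i\partial\overline z_j$, is positive definite at every point of $\partial D$. Subscripts $k$, $\overline\ell$ on $r$ denote $\partial/\partial z_k$, $\partial/\partial\overline z_\ell$, repeated indices are summed from $1$ to $n$, and $$[r^{i\overline j}]^t=H(r)^{-1},\quad r^i=r^{i\overline j}r_{\overline j},\quad r^{\overline j}=r^{i\overline j}r_i,\quad |\partial r|_r^2=r^{i\overline j}r_ir_{\overline j},\quad a^{i\overline j}=a^{i\overline j}[r]=r^{i\overline j}-\frac{r^ir^{\overline j}}{-r+|\partial r|_r^2},$$ $$\tilde\Delta f=a^{i\overline j}\frac{\partial^2f}{\partial z_i\partial\overline z_j},\qquad |\tilde\nabla f|^2=a^{i\overline j}\frac{\partial f}{\partial z_i}\frac{\partial f}{\partial\overline z_j},\qquad J(r)=-\det\begin{bmatrix} r&\overline\partial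 r\\ (\overline\partial r)^*&H(r)\end{bmatrix},$$ where $\overline\partial r=(r_{\overline1},\dots,r_{\overline n})$ and $(\overline\partial r)^*=(r_1,\dots,r_n)^t$. Put $$\tilde E(r)=\frac{|\partial r|_r^2}{n(n+1)}\Big[\tilde\Delta\log J(r)-\frac{n}{n+1}|\tilde\nabla\log J(r)|^2-2n\,\mathrm{Re}\,\frac{r^k\tilde\Delta r_k}{|\partial r|_r^2}\Big].$$ Then at every point of $\partial D$ $$\tilde E(r)\ \ge\ \frac{|\partial r|_r^2\,a^{k\overline\ell}}{n(n+1)}\Big[\tilde\Delta r_{k\overline\ell}-a^{i\overline q}r^{p\overline j}r_{i\overline jk}r_{p\overline q\overline\ell}-(\tilde\Delta r_k)(\tilde\Delta r_{\overline\ell})-n\,\frac{r^ir_{ik}\,r^{\overline j}r_{\overline j\overline\ell}}{|\partial r|_r^4}\Big]-\frac{2\,\mathrm{Re}\,r^k\tilde\Delta r_k}{n+1}$$ and $$\tilde E(r)\ \le\ \frac{|\partial r|_r^2\,a^{k\overline\ell}}{n(n+1)}\Big[\tilde\Delta r_{k\overline\ell}+\frac{a^{i\overline q}r^pr^{\overline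 j}r_{i\overline jk}r_{p\overline q\overline\ell}}{|\partial r|_r^2}+2\,\frac{a^{i\overline q}r_{ik}r_{\overline q\overline\ell}}{|\partial r|_r^2}\Big]-\frac{2\,\mathrm{Re}\,r^k\tilde\Delta r_k}{n+1}.$$ -/

import Mathlib

/-!
Complex calculus on `ℂⁿ = (Fin n → ℂ)` in index notation, for a real function `r`.
-/

noncomputable section

namespace Fefferman

variable {n : ℕ}

/-- The Wirtinger derivative `∂f/∂z_j = (∂f/∂x_j - i ∂f/∂y_j) / 2`. -/
def dz (j : Fin n) (f : (Fin n → ℂ) → ℂ) (z : Fin n → ℂ) : ℂ :=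
  (fderiv ℝ f z (Pi.single j 1) - Complex.I * fderiv ℝ f z (Pi.single j Complex.I)) / 2

/-- The Wirtinger derivative `∂f/∂z̄_j = (∂f/∂x_j + i ∂f/∂y_j) / 2`. -/
def dzbar (j : Fin n) (f : (Fin n → ℂ) → ℂ) (z : Fin n → ℂ) : ℂ :=
  (fderiv ℝ f z (Pi.single j 1) + Complex.I * fderiv ℝ f z (Pi.single j Complex.I)) / 2

/-- A real function regarded as a complex-valued one. -/
def toC (r : (Fin n → ℂ) → ℝ) (z : Fin n → ℂ) : ℂ := (r z : ℂ)

/-- The complex Hessian `H(r)`, with entries `r_{i j̄} = ∂²r/∂z_i∂z̄_j`. -/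
def hess (r : (Fin n → ℂ) → ℝ) (z : Fin n → ℂ) : Matrix (Fin n) (Fin n) ℂ :=
  Matrix.of fun i j => dz i (dzbar j (toC r)) z

open scoped ComplexOrder in
/-- `r` is strictly plurisubharmonic at every point of `S`: its complex Hessian is positive definite there. -/
def StrictlyPSHOn (r : (Fin n → ℂ) → ℝ) (S : Set (Fin n → ℂ)) : Prop :=
  ∀ z ∈ S, (hess r z).PosDef

/-- `r` is a negative defining function, of class `C^m` up to and across the boundary,
for the set `D`. -/
def IsDefiningFunction (m : ℕ) (D : Set (Fin n → ℂ)) (r : (Fin n → ℂ) → ℝ) : Prop :=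
  ∃ U : Set (Fin n → ℂ), IsOpen U ∧ closure D ⊆ U ∧ ContDiffOn ℝ m r U ∧
    D = {z ∈ U | r z < 0} ∧ ∀ z ∈ frontier D, fderiv ℝ r z ≠ 0

/-- The Fefferman operator
`J(r) = - det [[r, ∂̄r], [(∂̄r)^*, H(r)]]`; the matrix is Hermitian for `r` of class `C²`, so
that its determinant is real. -/
def feffermanJ (r : (Fin n → ℂ) → ℝ) (z : Fin n → ℂ) : ℝ :=
  (-(Matrix.fromBlocks
      (Matrix.of fun (_ _ : Unit) => toC r z)
      (Matrix.of fun (_ : Unit) (j : Fin n) => dzbar j (toC r) z)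
      (Matrix.of fun (i : Fin n) (_ : Unit) => dz i (toC r) z)
      (hess r z)).det).re

/-- `log J(r)`. -/
def logJ (r : (Fin n → ℂ) → ℝ) (z : Fin n → ℂ) : ℝ := Real.log (feffermanJ r z)

/-- `r^{i j̄}`, where `[r^{i j̄}]ᵗ = H(r)⁻¹`. -/
def rInv (r : (Fin n → ℂ) → ℝ) (z : Fin n → ℂ) (i j : Fin n) : ℂ := (hess r z)⁻¹ j i

/-- `r^i = ∑_j r^{i j̄} r_{j̄}`. -/
def rUp (r : (Fin n → ℂ) → ℝ) (z : Fin n → ℂ) (i : Fin n) : ℂ :=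
  ∑ j, rInv r z i j * dzbar j (toC r) z

/-- `r^{j̄} = ∑_i r^{i j̄} r_i`. -/
def rUpBar (r : (Fin n → ℂ) → ℝ) (z : Fin n → ℂ) (j : Fin n) : ℂ :=
  ∑ i, rInv r z i j * dz i (toC r) z

/-- `|∂r|²_r = ∑_{i,j} r^{i j̄} r_i r_{j̄}` (the sum is real since `[r^{i j̄}]` is Hermitian). -/
def gradSq (r : (Fin n → ℂ) → ℝ) (z : Fin n → ℂ) : ℝ :=
  (∑ i, ∑ j, rInv r z i j * dz i (toC r) z * dzbar j (toC r) z).re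

/-- `a^{i j̄}[r] = r^{i j̄} - r^i r^{j̄} / (-r + |∂r|²_r)`. -/
def aUp (r : (Fin n → ℂ) → ℝ) (z : Fin n → ℂ) (i j : Fin n) : ℂ :=
  rInv r z i j - rUp r z i * rUpBar r z j / ((-r z + gradSq r z : ℝ) : ℂ)

/-- `Δ̃ f = ∑_{i,j} a^{i j̄}[r] ∂²f/∂z_i∂z̄_j`. -/
def lapTilde (r : (Fin n → ℂ) → ℝ) (f : (Fin n → ℂ) → ℂ) (z : Fin n → ℂ) : ℂ :=
  ∑ i, ∑ j, aUp r z i j * dz i (dzbar j f) z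

/-- `|∇̃ f|² = ∑_{i,j} a^{i j̄}[r] (∂f/∂z_i) (∂f/∂z̄_j)`. -/
def gradTildeSq (r : (Fin n → ℂ) → ℝ) (f : (Fin n → ℂ) → ℂ) (z : Fin n → ℂ) : ℂ :=
  ∑ i, ∑ j, aUp r z i j * dz i f z * dzbar j f z

/-- `Ẽ(r) = |∂r|²_r / (n(n+1)) *
  [Δ̃ log J(r) - n |∇̃ log J(r)|² / (n+1) - 2n Re (∑_k r^k Δ̃ r_k / |∂r|²_r)]`. The first two terms
of the bracket are real because `log J(r)` is a real function. -/
def Etilde (r : (Fin n → ℂ) → ℝ) (z : Fin n → ℂ) : ℝ :=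
  gradSq r z / (n * (n + 1)) *
    ((lapTilde r (toC (logJ r)) z).re
      - n * (gradTildeSq r (toC (logJ r)) z).re / (n + 1)
      - 2 * n * ((∑ k, rUp r z k * lapTilde r (dz k (toC r)) z) / (gradSq r z : ℂ)).re)

/-- The third derivative `r_{i j̄ k}`. -/
def r3 (r : (Fin n → ℂ) → ℝ) (z : Fin n → ℂ) (i j k : Fin n) : ℂ :=
  dz k (dz i (dzbar j (toC r))) z

/-- The third derivative `r_{p q̄ l̄}`. -/
def r3bar (r : (Fin n → ℂ) → ℝ) (z : Fin n → ℂ) (p q l : Fin n) : ℂ :=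
  dzbar l (dz p (dzbar q (toC r))) z

/-- The second derivative `r_{i k}`. -/
def r2 (r : (Fin n → ℂ) → ℝ) (z : Fin n → ℂ) (i k : Fin n) : ℂ :=
  dz k (dz i (toC r)) z

/-- The second derivative `r_{q̄ l̄}`. -/
def r2bar (r : (Fin n → ℂ) → ℝ) (z : Fin n → ℂ) (q l : Fin n) : ℂ :=
  dzbar l (dzbar q (toC r)) z

end Fefferman

end

/-! On the boundary `r = 0`, so `J(r)` is minus the determinant of the bordered Hessian `M` with
zero corner, border `u = (r_1, …, r_n)ᵗ` and block `H = H(r)`. With `g = |∂r|²_r > 0`, the lower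
right block of `M⁻¹` is `A = H⁻¹ - g⁻¹ H⁻¹ u uᴴ H⁻¹`, the transpose of `[a^{i j̄}]`. Since `A` is
positive semidefinite and `A u = 0`, it factors as `Bᴴ B` with `B u = 0`
(`exists_tangential_frame`). Each contraction with `a^{k l̄}` is then a sum over the rows `v` of
`B`, all complex tangential, and both estimates reduce to a single such `v`.

For tangential `v`, differentiating `log (-det M)` twice gives (`contract_dz_dzbar_logJ`) `tr(A W) +
g⁻¹ |ξ - Y|²_A - tr(H⁻¹ Rᴴ A R)`, with `|X|²_A = tr(Xᴴ A X)`. Here `ξ`, `R`, `W` are the derivatives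
along `v` of the border, of `H`, and of `H` twice, and `Y = R H⁻¹ u`. The first derivative is `P +
g⁻¹ Q`, where `P = ∑ v_k Δ̃r_k` and `Q = ∑ v_k r^i r_{ik}` (`sum_dz_logJ`).

Lower bound (`contract_lower`): discard `|ξ - Y|²_A` and use `n/(n+1) |P + g⁻¹Q|² ≤ |P|² + n
g⁻²|Q|²`. Upper bound (`contract_upper`): discard the gradient term, use `|ξ - Y|²_A ≤ 2|ξ|²_A +
2|Y|²_A`, and absorb one `g⁻¹|Y|²_A` by `re_trace_conj_le`. -/

noncomputable section

namespace Fefferman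

open Filter Topology Matrix

variable {n : ℕ}

/-- The first order operator `f ↦ (∂f/∂x_j + ε ∂f/∂y_j) / 2`, as a functional of the differential;
`ε = -i` and `ε = i` give the two Wirtinger derivatives. -/
def wirtingerFunctional (ε : ℂ) (j : Fin n) : ((Fin n → ℂ) →L[ℝ] ℂ) →ₗ[ℂ] ℂ where
  toFun L := (L (Pi.single j 1) + ε * L (Pi.single j Complex.I)) / 2
  map_add' L L' := by simp; ring
  map_smul' c L := by simp; ring

/-- The operator `f ↦ (∂f/∂x_j + ε ∂f/∂y_j) / 2`. -/
def wirt (ε : ℂ) (j : Fin n) (f : (Fin n → ℂ) → ℂ) (z : Fin n → ℂ) : ℂ :=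
  wirtingerFunctional ε j (fderiv ℝ f z)

theorem dz_eq_wirt (j : Fin n) : dz j = wirt (-Complex.I) j := by
  ext f z
  simp [dz, wirt, wirtingerFunctional, sub_eq_add_neg]

theorem dzbar_eq_wirt (j : Fin n) : dzbar j = wirt Complex.I j := by
  ext f z
  simp [dzbar, wirt, wirtingerFunctional]

/-! ### Rules of calculus for the Wirtinger derivatives. -/

section Rules

variable {ε δ : ℂ} {j k : Fin n} {f g : (Fin n → ℂ) → ℂ} {z : Fin n → ℂ}

theorem wirt_congr (h : f =ᶠ[𝓝 z] g) : wirt ε j f z = wirt ε j g z := by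
  rw [wirt, wirt, h.fderiv_eq]

theorem wirt_eventuallyEq (h : f =ᶠ[𝓝 z] g) : wirt ε j f =ᶠ[𝓝 z] wirt ε j g := by
  filter_upwards [h.eventuallyEq_nhds] with y hy using wirt_congr hy

theorem wirt_const (c : ℂ) : wirt ε j (fun _ => c) z = 0 := by
  simp [wirt]

theorem wirt_mul (hf : DifferentiableAt ℝ f z) (hg : DifferentiableAt ℝ g z) :
    wirt ε j (fun y => f y * g y) z = f z * wirt ε j g z + wirt ε j f z * g z := by
  rw [wirt, fderiv_fun_mul hf hg, map_add, map_smul, map_smul]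
  simp [wirt, mul_comm]

theorem wirt_neg : wirt ε j (fun y => -f y) z = -wirt ε j f z := by
  rw [wirt, fderiv_fun_neg, map_neg, wirt]

theorem wirt_sum {ι : Type*} {s : Finset ι} {F : ι → (Fin n → ℂ) → ℂ}
    (hF : ∀ i ∈ s, DifferentiableAt ℝ (F i) z) :
    wirt ε j (fun y => ∑ i ∈ s, F i y) z = ∑ i ∈ s, wirt ε j (F i) z := by
  rw [wirt, fderiv_fun_sum hF, map_sum]
  rfl

theorem wirt_prod {ι : Type*} [DecidableEq ι] {s : Finset ι} {F : ι → (Fin n → ℂ) → ℂ}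
    (hF : ∀ i ∈ s, DifferentiableAt ℝ (F i) z) :
    wirt ε j (fun y => ∏ i ∈ s, F i y) z
      = ∑ i ∈ s, (∏ l ∈ s.erase i, F l z) * wirt ε j (F i) z := by
  rw [wirt, fderiv_finsetProd hF, map_sum]
  simp [wirt]

theorem wirt_log (hf : DifferentiableAt ℝ f z) (h0 : f z ∈ Complex.slitPlane) :
    wirt ε j (fun y => Complex.log (f y)) z = (f z)⁻¹ * wirt ε j f z := by
  have h := ((Complex.hasStrictDerivAt_log h0).hasDerivAt.hasFDerivAt.restrictScalars ℝ).comp z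
    hf.hasFDerivAt
  rw [wirt, show (fun y => Complex.log (f y)) = Complex.log ∘ f from rfl, h.fderiv,
    show ∀ L : (Fin n → ℂ) →L[ℝ] ℂ, (ContinuousLinearMap.restrictScalars ℝ
      (ContinuousLinearMap.toSpanSingleton ℂ (f z)⁻¹)).comp L = (f z)⁻¹ • L from
      fun L => by ext v; simp [mul_comm], map_smul]
  simp [wirt]

theorem star_wirt : star (wirt ε j f z) = wirt (star ε) j (fun y => star (f y)) z := by
  rw [wirt, wirt, fderiv_star]
  simp [wirtingerFunctional]

theorem contDiffAt_wirt {m : ℕ} (hf : ContDiffAt ℝ (m + 1 : ℕ) f z) :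
    ContDiffAt ℝ m (wirt ε j f) z := by
  have h : ContDiffAt ℝ m (fderiv ℝ f) z := hf.fderiv_right (by simp)
  have e : wirt ε j f = fun y => (fderiv ℝ f y (Pi.single j 1)
      + ε * fderiv ℝ f y (Pi.single j Complex.I)) / 2 := rfl
  rw [e]
  exact ((h.clm_apply contDiffAt_const).add
    (contDiffAt_const.mul (h.clm_apply contDiffAt_const))).div_const 2

/-- Both sides are the same combination of values of the second real differential, which is
symmetric for a `C²` function. Leaving `ε` and `δ` free treats all pairs of `∂` and `∂̄` at once. -/
theorem wirt_comm (hf : ContDiffAt ℝ (2 : ℕ) f z) :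
    wirt ε j (wirt δ k f) z = wirt δ k (wirt ε j f) z := by
  have hd : DifferentiableAt ℝ (fderiv ℝ f) z :=
    (hf.fderiv_right (m := (1 : ℕ)) (by norm_num)).differentiableAt (by simp)
  have hs : IsSymmSndFDerivAt ℝ f z := hf.isSymmSndFDerivAt (by simp)
  have key : ∀ (ε : ℂ) (j : Fin n) (v : Fin n → ℂ), fderiv ℝ (wirt ε j f) z v
      = (fderiv ℝ (fderiv ℝ f) z v (Pi.single j 1)
        + ε * fderiv ℝ (fderiv ℝ f) z v (Pi.single j Complex.I)) / 2 := by
    intro ε j v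
    have e : wirt ε j f = fun y => (fderiv ℝ f y (Pi.single j 1)
      + ε * fderiv ℝ f y (Pi.single j Complex.I)) * (2⁻¹ : ℂ) := rfl
    have h : ∀ w : Fin n → ℂ, HasFDerivAt (fun y => fderiv ℝ f y w)
        ((fderiv ℝ (fderiv ℝ f) z).flip w) z := fun w => by
      simpa using hd.hasFDerivAt.clm_apply (hasFDerivAt_const w z)
    have := (((h (Pi.single j 1)).fun_add ((h (Pi.single j Complex.I)).const_mul ε)).mul_const
      (2⁻¹ : ℂ))
    rw [e, this.fderiv]
    simp
    ring
  simp only [wirt, wirtingerFunctional, LinearMap.coe_mk, AddHom.coe_mk] at key ⊢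
  rw [key, key, key, key, hs.eq (Pi.single j 1) (Pi.single k 1),
    hs.eq (Pi.single j 1) (Pi.single k Complex.I),
    hs.eq (Pi.single j Complex.I) (Pi.single k 1),
    hs.eq (Pi.single j Complex.I) (Pi.single k Complex.I)]
  ring

theorem wirt_comm_eventuallyEq {m : ℕ} (hm : 2 ≤ m) (hf : ContDiffAt ℝ m f z) :
    wirt ε j (wirt δ k f) =ᶠ[𝓝 z] wirt δ k (wirt ε j f) := by
  filter_upwards [hf.eventually (by simp)] with y hy
  exact wirt_comm (hy.of_le (by exact_mod_cast hm))

end Rules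

/-! ### Derivatives of determinants, inverses and logarithms of determinants. -/

section MatrixCalculus

variable {ι : Type*} [Fintype ι] {ε δ : ℂ} {j k : Fin n}
  {F G : (Fin n → ℂ) → Matrix ι ι ℂ} {z : Fin n → ℂ}

/-- Entrywise derivative of a matrix valued function. -/
def wirtMatrix (ε : ℂ) (j : Fin n) {ι κ : Type*} (F : (Fin n → ℂ) → Matrix ι κ ℂ)
    (z : Fin n → ℂ) : Matrix ι κ ℂ :=
  Matrix.of fun a b => wirt ε j (fun y => F y a b) z

theorem wirtMatrix_mul (hF : ∀ a b, DifferentiableAt ℝ (fun y => F y a b) z)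
    (hG : ∀ a b, DifferentiableAt ℝ (fun y => G y a b) z) :
    wirtMatrix ε j (fun y => F y * G y) z
      = F z * wirtMatrix ε j G z + wirtMatrix ε j F z * G z := by
  ext a b
  simp only [wirtMatrix, Matrix.of_apply, Matrix.mul_apply, Matrix.add_apply]
  rw [wirt_sum fun i _ => (hF a i).fun_mul (hG i b), ← Finset.sum_add_distrib]
  exact Finset.sum_congr rfl fun i _ => wirt_mul (hF a i) (hG i b)

theorem wirt_trace (hF : ∀ a b, DifferentiableAt ℝ (fun y => F y a b) z) :
    wirt ε j (fun y => (F y).trace) z = (wirtMatrix ε j F z).trace := by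
  simp only [Matrix.trace, Matrix.diag_apply]
  rw [wirt_sum fun i _ => hF i i]
  rfl

variable [DecidableEq ι]

theorem contDiffAt_det {m : ℕ} (hF : ∀ a b, ContDiffAt ℝ m (fun y => F y a b) z) :
    ContDiffAt ℝ m (fun y => (F y).det) z := by
  simp only [Matrix.det_apply']
  exact ContDiffAt.sum fun σ _ => contDiffAt_const.mul (contDiffAt_prod fun i _ => hF _ _)

/-- Jacobi's formula. -/
theorem wirt_det (hF : ∀ a b, DifferentiableAt ℝ (fun y => F y a b) z) :
    wirt ε j (fun y => (F y).det) z = ((F z).adjugate * wirtMatrix ε j F z).trace := by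
  have hp : ∀ σ : Equiv.Perm ι, DifferentiableAt ℝ (fun y => ∏ i, F y (σ i) i) z := fun σ =>
    (HasFDerivAt.finsetProd fun i _ => (hF (σ i) i).hasFDerivAt).differentiableAt
  have h1 : wirt ε j (fun y => (F y).det) z = ∑ σ : Equiv.Perm ι, ((Equiv.Perm.sign σ : ℤ) : ℂ) *
      ∑ i, (∏ l ∈ Finset.univ.erase i, F z (σ l) l) * wirt ε j (fun y => F y (σ i) i) z := by
    simp only [Matrix.det_apply']
    rw [wirt_sum fun σ _ => (differentiableAt_const _).fun_mul (hp σ)]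
    refine Finset.sum_congr rfl fun σ _ => ?_
    rw [wirt_mul (differentiableAt_const _) (hp σ), wirt_const, zero_mul, add_zero,
      wirt_prod fun i _ => hF (σ i) i]
  have h2 : ∀ i, ((F z).adjugate * wirtMatrix ε j F z) i i
      = ∑ σ : Equiv.Perm ι, ((Equiv.Perm.sign σ : ℤ) : ℂ) *
        ((∏ l ∈ Finset.univ.erase i, F z (σ l) l) * wirt ε j (fun y => F y (σ i) i) z) := by
    intro i
    -- Cramer's rule: this diagonal entry is the determinant with column `i` replaced by its
    -- derivative.
    have : ((F z).adjugate * wirtMatrix ε j F z) i i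
        = ((F z).updateCol i fun a => wirtMatrix ε j F z a i).det := by
      rw [← Matrix.cramer_apply, Matrix.cramer_eq_adjugate_mulVec]
      rfl
    rw [this, Matrix.det_apply']
    refine Finset.sum_congr rfl fun σ _ => ?_
    rw [← Finset.prod_erase_mul _ _ (Finset.mem_univ i)]
    congr 2
    · refine Finset.prod_congr rfl fun l hl => ?_
      rw [Matrix.updateCol_ne (Finset.ne_of_mem_erase hl)]
    · simp [wirtMatrix]
  rw [h1, Matrix.trace]
  simp only [Matrix.diag_apply, h2, Finset.mul_sum]
  rw [Finset.sum_comm]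

/-- By Cramer's rule an entry of the inverse is a quotient of two determinants. -/
theorem contDiffAt_inv {m : ℕ} (hF : ∀ a b, ContDiffAt ℝ m (fun y => F y a b) z)
    (h0 : (F z).det ≠ 0) (a b : ι) : ContDiffAt ℝ m (fun y => (F y)⁻¹ a b) z := by
  have e : (fun y => (F y)⁻¹ a b)
      = fun y => ((F y).det)⁻¹ * ((F y).updateRow b (Pi.single a 1)).det := by
    ext y
    rw [Matrix.inv_def, Matrix.smul_apply, Matrix.adjugate_apply, Ring.inverse_eq_inv', smul_eq_mul]
  rw [e]
  refine ((contDiffAt_det hF).inv h0).mul (contDiffAt_det fun c d => ?_)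
  by_cases hc : c = b
  · subst hc
    simpa using contDiffAt_const
  · simpa [Matrix.updateRow_ne hc] using hF c d

/-- Differentiate `F⁻¹ F = 1`, which holds near `z` because the determinant stays nonzero there. -/
theorem wirtMatrix_inv (hF : ∀ a b, ContDiffAt ℝ (1 : ℕ) (fun y => F y a b) z)
    (h0 : (F z).det ≠ 0) :
    wirtMatrix ε j (fun y => (F y)⁻¹) z = -((F z)⁻¹ * wirtMatrix ε j F z * (F z)⁻¹) := by
  have hu : IsUnit (F z).det := isUnit_iff_ne_zero.mpr h0
  have hd : ∀ a b, DifferentiableAt ℝ (fun y => F y a b) z := fun a b =>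
    (hF a b).differentiableAt (by simp)
  have hi : ∀ a b, DifferentiableAt ℝ (fun y => (F y)⁻¹ a b) z := fun a b =>
    (contDiffAt_inv hF h0 a b).differentiableAt (by simp)
  have hne : ∀ᶠ y in 𝓝 z, (F y).det ≠ 0 :=
    (contDiffAt_det hF).continuousAt.eventually_ne h0
  have h1 : wirtMatrix ε j (fun y => (F y)⁻¹ * F y) z = 0 := by
    ext a b
    have : (fun y => ((F y)⁻¹ * F y) a b) =ᶠ[𝓝 z] fun _ => (1 : Matrix ι ι ℂ) a b := by
      filter_upwards [hne] with y hy
      rw [Matrix.nonsing_inv_mul _ (isUnit_iff_ne_zero.mpr hy)]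
    simp only [wirtMatrix, Matrix.of_apply, Matrix.zero_apply]
    rw [wirt_congr this, wirt_const]
  rw [wirtMatrix_mul hi hd] at h1
  have h2 := congrArg (· * (F z)⁻¹) h1
  simp only [Matrix.add_mul, Matrix.zero_mul, Matrix.mul_assoc,
    Matrix.mul_nonsing_inv _ hu, Matrix.mul_one] at h2
  rw [eq_neg_iff_add_eq_zero, add_comm, ← h2, Matrix.mul_assoc]

/-- The logarithmic derivative of a determinant. -/
theorem wirt_log_neg_det (hF : ∀ a b, DifferentiableAt ℝ (fun y => F y a b) z)
    (h0 : -(F z).det ∈ Complex.slitPlane) :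
    wirt ε j (fun y => Complex.log (-(F y).det)) z = ((F z)⁻¹ * wirtMatrix ε j F z).trace := by
  have hd : DifferentiableAt ℝ (fun y => (F y).det) z := by
    simp only [Matrix.det_apply']
    exact DifferentiableAt.fun_sum fun σ _ => (differentiableAt_const _).mul
      (HasFDerivAt.finsetProd fun i _ => (hF (σ i) i).hasFDerivAt).differentiableAt
  rw [wirt_log hd.fun_neg h0, wirt_neg, wirt_det hF, Matrix.inv_def, Matrix.smul_mul,
    Matrix.trace_smul, Ring.inverse_eq_inv', smul_eq_mul, inv_neg]
  ring

/-- The trace formula for the first derivative persists on a neighbourhood, so it can be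
differentiated by the product rule. -/
theorem wirt_wirt_log_neg_det (hF : ∀ a b, ContDiffAt ℝ (2 : ℕ) (fun y => F y a b) z)
    (h0 : -(F z).det ∈ Complex.slitPlane) :
    wirt δ k (wirt ε j fun y => Complex.log (-(F y).det)) z
      = ((F z)⁻¹ * wirtMatrix δ k (wirtMatrix ε j F) z).trace
        - ((F z)⁻¹ * wirtMatrix δ k F z * (F z)⁻¹ * wirtMatrix ε j F z).trace := by
  have h0' : (F z).det ≠ 0 := fun h => by simp [h] at h0
  have hF1 : ∀ a b, ContDiffAt ℝ (1 : ℕ) (fun y => F y a b) z := fun a b =>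
    (hF a b).of_le (by norm_num)
  have hev : (wirt ε j fun y => Complex.log (-(F y).det))
      =ᶠ[𝓝 z] fun y => ((F y)⁻¹ * wirtMatrix ε j F y).trace := by
    have h1 : ∀ᶠ y in 𝓝 z, ∀ a b, ContDiffAt ℝ (2 : ℕ) (fun y => F y a b) y :=
      eventually_all.2 fun a => eventually_all.2 fun b => (hF a b).eventually (by simp)
    have h2 : ∀ᶠ y in 𝓝 z, -(F y).det ∈ Complex.slitPlane :=
      (contDiffAt_det hF).continuousAt.neg.eventually (Complex.isOpen_slitPlane.mem_nhds h0)
    filter_upwards [h1, h2] with y hy hy'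
    exact wirt_log_neg_det (fun a b => (hy a b).differentiableAt (by simp)) hy'
  have hi : ∀ a b, DifferentiableAt ℝ (fun y => (F y)⁻¹ a b) z := fun a b =>
    (contDiffAt_inv hF1 h0' a b).differentiableAt (by simp)
  have hw : ∀ a b, DifferentiableAt ℝ (fun y => wirtMatrix ε j F y a b) z := fun a b =>
    (contDiffAt_wirt (m := 1) (hF a b)).differentiableAt (by simp)
  rw [wirt_congr hev, wirt_trace, wirtMatrix_mul hi hw, wirtMatrix_inv hF1 h0', Matrix.trace_add,
    Matrix.neg_mul, Matrix.trace_neg, sub_eq_add_neg]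
  intro a b
  simp only [Matrix.mul_apply]
  exact DifferentiableAt.fun_sum fun i _ => (hi a i).mul (hw i b)

end MatrixCalculus

open scoped ComplexOrder in
theorem re_trace_conj_nonneg {κ : Type*} [Fintype κ] {ι : Type*} [Fintype ι]
    {A : Matrix ι ι ℂ} (hA : A.PosSemidef)
    (X : Matrix ι κ ℂ) : 0 ≤ (Xᴴ * A * X).trace.re :=
  (Complex.le_def.1 (hA.conjTranspose_mul_mul_same X).trace_nonneg).1

theorem trace_fromBlocks_unit {ι : Type*} [Fintype ι] (P : Matrix Unit Unit ℂ)
    (Q : Matrix Unit ι ℂ) (S : Matrix ι Unit ℂ) (T : Matrix ι ι ℂ) :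
    (fromBlocks P Q S T).trace = P.trace + T.trace := by
  simp [Matrix.trace]

/-! ### Linear algebra of the bordered Hessian and its tangential inverse. -/

section BorderedMatrix

variable {ι : Type*} [Fintype ι]

/-- The second variation of the logarithm of a bordered determinant, in a direction annihilated
by the border. -/
theorem trace_bordered (α : ℂ) (V b ξ' : Matrix Unit ι ℂ) (V' c ξ : Matrix ι Unit ℂ)
    (H A R R' W : Matrix ι ι ℂ) (hVA : V * H * A = V) (hAV : A * (H * V') = V')
    (hb : b * (H * V') = 0) (hc : V * H * c = 0) :
    (fromBlocks (α • 1) b c A * fromBlocks (V * H * V') (V * R') (R * V') W).trace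
      - (fromBlocks (α • 1) b c A * fromBlocks 0 (V * H) ξ R * fromBlocks (α • 1) b c A
          * fromBlocks 0 ξ' (H * V') R').trace
      = (A * W).trace - α * (ξ' * A * ξ).trace - (b * R' * A * ξ).trace - (ξ' * A * R * c).trace
        - (A * R * A * R').trace := by
  rw [Matrix.mul_assoc (fromBlocks (α • 1) b c A * fromBlocks 0 (V * H) ξ R)]
  simp only [fromBlocks_multiply, trace_fromBlocks_unit, Matrix.mul_zero, zero_add, hb, hAV]
  have e1 : (c * (V * H) + A * R) * (c * ξ' + A * R')
      = c * (V * H * c) * ξ' + c * (V * H * A) * R' + A * R * c * ξ' + A * R * A * R' := by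
    simp only [Matrix.add_mul, Matrix.mul_add, Matrix.mul_assoc]
    abel
  rw [e1, hVA, hc]
  simp only [Matrix.add_mul, Matrix.mul_add, Matrix.trace_add, Matrix.mul_zero, Matrix.zero_mul,
    zero_add, Matrix.smul_mul, Matrix.mul_smul, Matrix.one_mul,
    Matrix.trace_smul, smul_eq_mul]
  have t1 : (c * (V * R')).trace = (c * V * R').trace := by rw [Matrix.mul_assoc]
  have t2 : (b * (R * V')).trace = (b * R * V').trace := by rw [Matrix.mul_assoc]
  have t3 : (A * ξ * ξ').trace = (ξ' * A * ξ).trace := by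
    rw [Matrix.trace_mul_comm, ← Matrix.mul_assoc]
  have t4 : (A * ξ * (b * R')).trace = (b * R' * A * ξ).trace := by
    rw [Matrix.trace_mul_comm]; simp only [Matrix.mul_assoc]
  have t5 : (A * R * c * ξ').trace = (ξ' * A * R * c).trace := by
    rw [Matrix.trace_mul_comm]; simp only [Matrix.mul_assoc]
  rw [t1, t2, t3, t4, t5]
  ring

variable [DecidableEq ι] {H : Matrix ι ι ℂ} {u : Matrix ι Unit ℂ} {g : ℝ}

/-- `H⁻¹ - g⁻¹ H⁻¹ u uᴴ H⁻¹`. -/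
def tangentialInv (H : Matrix ι ι ℂ) (u : Matrix ι Unit ℂ) (g : ℝ) : Matrix ι ι ℂ :=
  H⁻¹ - (g : ℂ)⁻¹ • (H⁻¹ * u * (uᴴ * H⁻¹))

theorem trace_tangentialInv_mul (X : Matrix ι ι ℂ) :
    (tangentialInv H u g * X).trace
      = (H⁻¹ * X).trace - (g : ℂ)⁻¹ * (uᴴ * H⁻¹ * X * (H⁻¹ * u)).trace := by
  rw [tangentialInv, Matrix.sub_mul, Matrix.trace_sub, Matrix.smul_mul, Matrix.trace_smul,
    smul_eq_mul, Matrix.mul_assoc (H⁻¹ * u), Matrix.trace_mul_comm (H⁻¹ * u)]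

theorem tangentialInv_mul_border (hg : g ≠ 0) (hu : uᴴ * H⁻¹ * u = (g : ℂ) • 1) :
    tangentialInv H u g * u = 0 := by
  have hg' : (g : ℂ) ≠ 0 := by exact_mod_cast hg
  rw [tangentialInv, Matrix.sub_mul, Matrix.smul_mul, Matrix.mul_assoc _ _ u, hu, Matrix.mul_smul,
    smul_smul, inv_mul_cancel₀ hg', one_smul, Matrix.mul_one, sub_self]

theorem mul_tangentialInv (hH : IsUnit H.det) :
    H * tangentialInv H u g = 1 - (g : ℂ)⁻¹ • (u * (uᴴ * H⁻¹)) := by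
  rw [tangentialInv, Matrix.mul_sub, Matrix.mul_nonsing_inv _ hH, Matrix.mul_smul,
    Matrix.mul_assoc H⁻¹, Matrix.mul_nonsing_inv_cancel_left _ _ hH]

theorem tangentialInv_mul (hH : IsUnit H.det) :
    tangentialInv H u g * H = 1 - (g : ℂ)⁻¹ • (H⁻¹ * u * uᴴ) := by
  rw [tangentialInv, Matrix.sub_mul, Matrix.nonsing_inv_mul _ hH, Matrix.smul_mul,
    ← Matrix.mul_assoc (H⁻¹ * u), Matrix.nonsing_inv_mul_cancel_right _ _ hH]

theorem tangentialInv_isHermitian (hH : H.IsHermitian) : (tangentialInv H u g).IsHermitian := by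
  have : H⁻¹ᴴ = H⁻¹ := hH.inv
  simp [IsHermitian, tangentialInv, this, Matrix.mul_assoc]

/-- Block inversion through the Schur complement `-g` of `H`. It explains the role of `a^{i j̄}`: up
to transposition it is the lower right block of the inverse. -/
theorem bordered_mul_inv (hH : IsUnit H.det) (hg : g ≠ 0) (hu : uᴴ * H⁻¹ * u = (g : ℂ) • 1) :
    fromBlocks 0 uᴴ u H * fromBlocks ((-(g : ℂ)⁻¹) • 1) ((g : ℂ)⁻¹ • (uᴴ * H⁻¹))
      ((g : ℂ)⁻¹ • (H⁻¹ * u)) (tangentialInv H u g) = 1 := by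
  have hg' : (g : ℂ) ≠ 0 := by exact_mod_cast hg
  rw [fromBlocks_multiply, mul_tangentialInv hH]
  have h1 : uᴴ * tangentialInv H u g = 0 := by
    rw [tangentialInv, Matrix.mul_sub, Matrix.mul_smul, ← Matrix.mul_assoc, ← Matrix.mul_assoc uᴴ,
      hu, Matrix.smul_mul, smul_smul, inv_mul_cancel₀ hg', one_smul, Matrix.one_mul, sub_self]
  rw [h1]
  simp only [Matrix.mul_smul, ← Matrix.mul_assoc, hu, Matrix.mul_nonsing_inv _ hH, Matrix.zero_mul,
    zero_add, Matrix.one_mul, smul_smul, inv_mul_cancel₀ hg', one_smul,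
    neg_smul, add_sub_cancel]
  simp

open scoped ComplexOrder

/-- `H A` differs from the identity by a matrix with column space in the span of `u`, which `A`
kills; hence `A = Aᴴ H A`. -/
theorem tangentialInv_posSemidef (hH : H.PosDef) (hg : g ≠ 0) (hu : uᴴ * H⁻¹ * u = (g : ℂ) • 1) :
    (tangentialInv H u g).PosSemidef := by
  have hdet : IsUnit H.det := (Matrix.isUnit_iff_isUnit_det H).1 hH.isUnit
  have h1 : (tangentialInv H u g)ᴴ * H * tangentialInv H u g = tangentialInv H u g := by
    rw [tangentialInv_isHermitian hH.isHermitian, Matrix.mul_assoc, mul_tangentialInv hdet,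
      Matrix.mul_sub, Matrix.mul_one, Matrix.mul_smul, ← Matrix.mul_assoc,
      tangentialInv_mul_border hg hu, Matrix.zero_mul, smul_zero, sub_zero]
  rw [← h1]
  exact hH.posSemidef.conjTranspose_mul_mul_same _

/-- From `A u = 0` one gets `Bᴴ B u = 0`, hence `B u = 0`: the rows of any factor `B` are tangential
directions. -/
theorem exists_tangential_frame (hH : H.PosDef) (hg : g ≠ 0)
    (hu : uᴴ * H⁻¹ * u = (g : ℂ) • 1) :
    ∃ B : Matrix ι ι ℂ, tangentialInv H u g = Bᴴ * B ∧ B * u = 0 := by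
  obtain ⟨B, hB⟩ : ∃ B : Matrix ι ι ℂ, tangentialInv H u g = Bᴴ * B := by
    classical
    open scoped MatrixOrder in
    exact (CStarAlgebra.nonneg_iff_eq_star_mul_self).1 (tangentialInv_posSemidef hH hg hu).nonneg
  refine ⟨B, hB, ?_⟩
  rw [← Matrix.conjTranspose_mul_self_mul_eq_zero, ← hB, tangentialInv_mul_border hg hu]

/-- Completing the square: expanding one factor `A` in `tr(A Rᴴ A R)` produces `-g⁻¹ |R H⁻¹ u|²_A`,
which joins the `ξ` terms into one square. Tangency `V u = 0` supplies the four hypotheses of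
`trace_bordered`. -/
theorem trace_bordered_eq (hH : H.PosDef) (hg : g ≠ 0) (hu : uᴴ * H⁻¹ * u = (g : ℂ) • 1)
    {V : Matrix Unit ι ℂ} (hV : V * u = 0) (ξ : Matrix ι Unit ℂ) (R W : Matrix ι ι ℂ) :
    ((fromBlocks 0 uᴴ u H)⁻¹ * fromBlocks (V * H * Vᴴ) (V * Rᴴ) (R * Vᴴ) W).trace
      - ((fromBlocks 0 uᴴ u H)⁻¹ * fromBlocks 0 (V * H) ξ R * (fromBlocks 0 uᴴ u H)⁻¹
          * fromBlocks 0 ξᴴ (H * Vᴴ) Rᴴ).trace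
      = (tangentialInv H u g * W).trace
        + (g : ℂ)⁻¹ * ((ξ - R * (H⁻¹ * u))ᴴ * tangentialInv H u g * (ξ - R * (H⁻¹ * u))).trace
        - (H⁻¹ * Rᴴ * tangentialInv H u g * R).trace := by
  have hdet : IsUnit H.det := (Matrix.isUnit_iff_isUnit_det H).1 hH.isUnit
  have hi : H⁻¹ᴴ = H⁻¹ := hH.isHermitian.inv
  have hV' : uᴴ * Vᴴ = 0 := by rw [← Matrix.conjTranspose_mul, hV, Matrix.conjTranspose_zero]
  rw [Matrix.inv_eq_right_inv (bordered_mul_inv hdet hg hu), trace_bordered]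
  · set A := tangentialInv H u g with hA
    have e : (A * R * A * Rᴴ).trace = (A * (Rᴴ * A * R)).trace := by
      rw [Matrix.mul_assoc (A * R), Matrix.trace_mul_comm]
      simp only [Matrix.mul_assoc]
    rw [e, hA, trace_tangentialInv_mul (X := Rᴴ * _ * R), ← hA]
    simp only [Matrix.conjTranspose_sub, Matrix.conjTranspose_mul, hi, Matrix.sub_mul,
      Matrix.mul_sub, Matrix.trace_sub, Matrix.smul_mul, Matrix.mul_smul, Matrix.trace_smul,
      smul_eq_mul, Matrix.mul_assoc]
    ring
  · rw [Matrix.mul_assoc, mul_tangentialInv hdet, Matrix.mul_sub, Matrix.mul_one, Matrix.mul_smul,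
      ← Matrix.mul_assoc, hV, Matrix.zero_mul, smul_zero, sub_zero]
  · rw [← Matrix.mul_assoc, tangentialInv_mul hdet, Matrix.sub_mul, Matrix.one_mul,
      Matrix.smul_mul, Matrix.mul_assoc _ _ Vᴴ, hV', Matrix.mul_zero, smul_zero, sub_zero]
  · rw [Matrix.smul_mul, Matrix.mul_assoc, Matrix.nonsing_inv_mul_cancel_left _ _ hdet, hV',
      smul_zero]
  · rw [Matrix.mul_smul, Matrix.mul_assoc, Matrix.mul_nonsing_inv_cancel_left _ _ hdet, hV,
      smul_zero]

/-- The difference of the two sides is `tr(A Rᴴ A R)`, which is nonnegative as the `A`-square of `R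
Bᴴ` when `A = Bᴴ B`. -/
theorem re_trace_conj_le (hH : H.PosDef) (hg : g ≠ 0) (hu : uᴴ * H⁻¹ * u = (g : ℂ) • 1)
    (R : Matrix ι ι ℂ) :
    ((g : ℂ)⁻¹ * ((R * (H⁻¹ * u))ᴴ * tangentialInv H u g * (R * (H⁻¹ * u))).trace).re
      ≤ (H⁻¹ * Rᴴ * tangentialInv H u g * R).trace.re := by
  set A := tangentialInv H u g with hA
  have hAp : A.PosSemidef := tangentialInv_posSemidef hH hg hu
  obtain ⟨B, hB, -⟩ := exists_tangential_frame hH hg hu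
  rw [← hA] at hB
  have h0 : 0 ≤ ((R * Bᴴ)ᴴ * A * (R * Bᴴ)).trace.re := re_trace_conj_nonneg hAp _
  have h1 : ((R * Bᴴ)ᴴ * A * (R * Bᴴ)).trace = (A * (Rᴴ * A * R)).trace := by
    have : (R * Bᴴ)ᴴ * A * (R * Bᴴ) = B * (Rᴴ * A * R) * Bᴴ := by
      rw [Matrix.conjTranspose_mul, Matrix.conjTranspose_conjTranspose]
      simp only [Matrix.mul_assoc]
    rw [this, Matrix.trace_mul_comm, ← Matrix.mul_assoc, ← hB]
  have hi : H⁻¹ᴴ = H⁻¹ := hH.isHermitian.inv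
  have h2 : (A * (Rᴴ * A * R)).trace = (H⁻¹ * Rᴴ * A * R).trace
      - (g : ℂ)⁻¹ * ((R * (H⁻¹ * u))ᴴ * A * (R * (H⁻¹ * u))).trace := by
    rw [hA, trace_tangentialInv_mul]
    simp only [Matrix.mul_assoc, Matrix.conjTranspose_mul, hi]
  rw [h1, h2, Complex.sub_re] at h0
  linarith

end BorderedMatrix

/-! ### Reality and Hermitian symmetry of the derivatives of `r`. -/

section RealFunction

variable (r : (Fin n → ℂ) → ℝ) (z : Fin n → ℂ)

theorem star_toC : star (toC r z) = toC r z := Complex.conj_ofReal _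

theorem star_dz (j : Fin n) (f : (Fin n → ℂ) → ℂ) :
    star (dz j f z) = dzbar j (fun y => star (f y)) z := by
  rw [dz_eq_wirt, dzbar_eq_wirt, star_wirt]
  simp

theorem star_dzbar (j : Fin n) (f : (Fin n → ℂ) → ℂ) :
    star (dzbar j f z) = dz j (fun y => star (f y)) z := by
  rw [dz_eq_wirt, dzbar_eq_wirt, star_wirt]
  simp

theorem star_dz_toC (j : Fin n) : star (dz j (toC r) z) = dzbar j (toC r) z := by
  simp only [star_dz, star_toC]

theorem star_dzbar_toC (j : Fin n) : star (dzbar j (toC r) z) = dz j (toC r) z := by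
  simp only [star_dzbar, star_toC]

/-- The column `(r_1, …, r_n)ᵗ`. -/
def gradCol : Matrix (Fin n) Unit ℂ := Matrix.of fun i _ => dz i (toC r) z

/-- The bordered complex Hessian. -/
def bordered : Matrix (Unit ⊕ Fin n) (Unit ⊕ Fin n) ℂ :=
  Matrix.fromBlocks
      (Matrix.of fun (_ _ : Unit) => toC r z)
      (Matrix.of fun (_ : Unit) (j : Fin n) => dzbar j (toC r) z)
      (Matrix.of fun (i : Fin n) (_ : Unit) => dz i (toC r) z)
      (hess r z)

variable {r z}

theorem hess_isHermitian (h : ContDiffAt ℝ (2 : ℕ) (toC r) z) : (hess r z).IsHermitian := by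
  ext i j
  simp only [conjTranspose_apply, hess, Matrix.of_apply, star_dz, star_dzbar_toC]
  simp only [dz_eq_wirt, dzbar_eq_wirt]
  exact wirt_comm h

theorem bordered_isHermitian (h : ContDiffAt ℝ (2 : ℕ) (toC r) z) :
    (bordered r z).IsHermitian := by
  rw [bordered, Matrix.isHermitian_fromBlocks_iff]
  refine ⟨?_, ?_, ?_, hess_isHermitian h⟩
  · ext; simp [star_toC, -Complex.star_def, -RCLike.star_def]
  · ext; simp [star_dzbar_toC, -Complex.star_def, -RCLike.star_def]
  · ext; simp [star_dz_toC, -Complex.star_def, -RCLike.star_def]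

/-- The bordered matrix is Hermitian, so taking the real part in `feffermanJ` loses nothing. -/
theorem neg_det_bordered (h : ContDiffAt ℝ (2 : ℕ) (toC r) z) :
    -(bordered r z).det = (feffermanJ r z : ℂ) := by
  have h1 : star (bordered r z).det = (bordered r z).det := by
    rw [← Matrix.det_conjTranspose, bordered_isHermitian h]
  have h2 : ((bordered r z).det.re : ℂ) = (bordered r z).det := Complex.conj_eq_iff_re.1 h1
  have h3 : feffermanJ r z = (-(bordered r z).det).re := rfl
  rw [h3, Complex.neg_re, Complex.ofReal_neg, h2]

theorem contDiffAt_bordered (h : ContDiffAt ℝ (4 : ℕ) (toC r) z) (a b : Unit ⊕ Fin n) :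
    ContDiffAt ℝ (2 : ℕ) (fun y => bordered r y a b) z := by
  have h3 : ∀ ε j, ContDiffAt ℝ (3 : ℕ) (wirt ε j (toC r)) z := fun ε j => contDiffAt_wirt h
  rcases a with a | i <;> rcases b with b | j
  · exact h.of_le (by norm_num)
  · simp only [bordered, fromBlocks_apply₁₂, Matrix.of_apply, dzbar_eq_wirt]
    exact (h3 _ _).of_le (by norm_num)
  · simp only [bordered, fromBlocks_apply₂₁, Matrix.of_apply, dz_eq_wirt]
    exact (h3 _ _).of_le (by norm_num)
  · simp only [bordered, fromBlocks_apply₂₂, hess, Matrix.of_apply, dz_eq_wirt, dzbar_eq_wirt]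
    exact contDiffAt_wirt (h3 _ _)

/-- For real `r`, the real and imaginary parts of `r_j` are, up to constants, the partial
derivatives in `x_j` and `y_j`. -/
theorem gradCol_ne_zero (hd : DifferentiableAt ℝ r z) (h : fderiv ℝ r z ≠ 0) :
    gradCol r z ≠ 0 := by
  intro h0
  apply h
  have h1 : ∀ v, fderiv ℝ (toC r) z v = (fderiv ℝ r z v : ℂ) := fun v => by
    have := (Complex.ofRealCLM.hasFDerivAt (x := r z)).comp z hd.hasFDerivAt
    rw [show toC r = Complex.ofRealCLM ∘ r from rfl, this.fderiv]
    rfl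
  have h2 : ∀ j, fderiv ℝ r z (Pi.single j 1) = 0 ∧ fderiv ℝ r z (Pi.single j Complex.I) = 0 := by
    intro j
    have h3 : dz j (toC r) z = 0 := congrFun (congrFun h0 j) ()
    rw [dz, h1, h1] at h3
    have h4 := congrArg Complex.re h3
    have h5 := congrArg Complex.im h3
    simp at h4 h5
    exact ⟨h4, h5⟩
  ext v
  have hv : v = ∑ j, ((v j).re • (Pi.single j 1 : Fin n → ℂ)
      + (v j).im • (Pi.single j Complex.I : Fin n → ℂ)) := by
    ext i
    simp [Finset.sum_apply, Pi.single_apply, Finset.sum_add_distrib]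
  rw [hv, map_sum]
  simp [h2]

end RealFunction

/-- The standing assumptions at a boundary point. -/
structure IsStrictBoundaryPoint (r : (Fin n → ℂ) → ℝ) (z : Fin n → ℂ) : Prop where
  contDiffAt : ContDiffAt ℝ (4 : ℕ) (toC r) z
  eq_zero : r z = 0
  grad_ne_zero : gradCol r z ≠ 0
  posDef : open scoped ComplexOrder in (hess r z).PosDef

/-! ### Index notation in matrix form, and derivatives of `log J(r)`, at a boundary point. -/

namespace IsStrictBoundaryPoint

open scoped ComplexOrder

variable {r : (Fin n → ℂ) → ℝ} {z : Fin n → ℂ}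

theorem gradCol_form (h : IsStrictBoundaryPoint r z) :
    (gradCol r z)ᴴ * (hess r z)⁻¹ * gradCol r z = (gradSq r z : ℂ) • 1 ∧ 0 < gradSq r z := by
  have hx : (gradCol r z).col () ≠ 0 := fun h0 => h.grad_ne_zero (by
    ext i j
    exact congrFun h0 i)
  have h1 := (h.posDef.inv).dotProduct_mulVec_pos hx
  have e : star ((gradCol r z).col ()) ⬝ᵥ ((hess r z)⁻¹ *ᵥ (gradCol r z).col ())
      = ∑ i, ∑ j, rInv r z i j * dz i (toC r) z * dzbar j (toC r) z := by
    simp only [dotProduct, mulVec, Finset.mul_sum]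
    rw [Finset.sum_comm]
    refine Finset.sum_congr rfl fun i _ => Finset.sum_congr rfl fun j _ => ?_
    simp only [Pi.star_apply, gradCol, Matrix.col_apply, Matrix.of_apply, star_dz_toC, rInv]
    ring
  have hre := Complex.lt_def.1 h1
  rw [e] at hre
  refine ⟨?_, hre.1⟩
  have h2 : (gradSq r z : ℂ) = ∑ i, ∑ j, rInv r z i j * dz i (toC r) z * dzbar j (toC r) z :=
    Complex.ext rfl (by simpa using hre.2)
  rw [h2, ← e]
  ext a b
  simp only [Matrix.mul_assoc, Matrix.smul_apply, Matrix.one_apply_eq, smul_eq_mul, mul_one]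
  rfl

theorem gradSq_pos (h : IsStrictBoundaryPoint r z) : 0 < gradSq r z := h.gradCol_form.2

theorem rUp_eq (i : Fin n) : rUp r z i = ((gradCol r z)ᴴ * (hess r z)⁻¹) () i := by
  simp only [rUp, rInv, Matrix.mul_apply, conjTranspose_apply, gradCol, Matrix.of_apply,
    star_dz_toC]
  exact Finset.sum_congr rfl fun j _ => mul_comm _ _

theorem rUpBar_eq (i : Fin n) : rUpBar r z i = ((hess r z)⁻¹ * gradCol r z) i () := by
  simp only [rUpBar, rInv, Matrix.mul_apply, gradCol, Matrix.of_apply]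

/-- At `r = 0` the denominator is `|∂r|²_r`. The indices are swapped because `[r^{i j̄}]` is the
transpose of `H⁻¹`. -/
theorem aUp_eq (h : IsStrictBoundaryPoint r z) (i j : Fin n) :
    aUp r z i j = tangentialInv (hess r z) (gradCol r z) (gradSq r z) j i := by
  rw [aUp, h.eq_zero, neg_zero, zero_add, tangentialInv, Matrix.sub_apply, Matrix.smul_apply,
    Matrix.mul_apply (M := _ * gradCol r z)]
  simp only [Finset.univ_unique, PUnit.default_eq_unit, Finset.sum_singleton, rUp_eq, rUpBar_eq,
    smul_eq_mul, rInv]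
  ring

theorem bordered_eq (h : IsStrictBoundaryPoint r z) :
    bordered r z = fromBlocks 0 (gradCol r z)ᴴ (gradCol r z) (hess r z) := by
  rw [bordered]
  congr 1
  · ext; simp [toC, h.eq_zero]
  · ext i j
    simp only [conjTranspose_apply, gradCol, Matrix.of_apply, star_dz_toC]

/-- By the Schur complement, `J(r) = det H(r) · |∂r|²_r` where `r = 0`. -/
theorem feffermanJ_pos (h : IsStrictBoundaryPoint r z) : 0 < feffermanJ r z := by
  have h2 : ContDiffAt ℝ (2 : ℕ) (toC r) z := h.contDiffAt.of_le (by norm_num)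
  have hdet : IsUnit (hess r z).det :=
    (Matrix.isUnit_iff_isUnit_det _).1 h.posDef.isUnit
  let := Matrix.invertibleOfIsUnitDet _ hdet
  have e : (feffermanJ r z : ℂ) = (hess r z).det * (gradSq r z : ℂ) := by
    rw [← neg_det_bordered h2, h.bordered_eq, Matrix.det_fromBlocks₂₂, Matrix.invOf_eq_nonsing_inv,
      h.gradCol_form.1]
    simp
  have hp := Complex.lt_def.1 h.posDef.det_pos
  have e2 := congrArg Complex.re e
  rw [Complex.ofReal_re, Complex.re_mul_ofReal] at e2
  rw [e2]
  exact mul_pos hp.1 h.gradSq_pos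

/-- `J(r)` stays positive nearby, so the real logarithm is the principal complex one and the
determinant formulas apply. -/
theorem logJ_eventuallyEq (h : IsStrictBoundaryPoint r z) :
    toC (logJ r) =ᶠ[𝓝 z] fun y => Complex.log (-(bordered r y).det) := by
  have hc : ContinuousAt (fun y => (-(bordered r y).det).re) z :=
    Complex.continuous_re.continuousAt.comp
      (contDiffAt_det (contDiffAt_bordered h.contDiffAt)).continuousAt.neg
  have hpos : ∀ᶠ y in 𝓝 z, 0 < feffermanJ r y := hc.eventually_const_lt h.feffermanJ_pos
  filter_upwards [hpos, h.contDiffAt.eventually (by simp)] with y hy hy'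
  rw [neg_det_bordered (hy'.of_le (by norm_num)), toC, logJ, Complex.ofReal_log hy.le]

theorem neg_det_mem_slitPlane (h : IsStrictBoundaryPoint r z) :
    -(bordered r z).det ∈ Complex.slitPlane := by
  rw [neg_det_bordered (h.contDiffAt.of_le (by norm_num))]
  exact Complex.ofReal_mem_slitPlane.2 h.feffermanJ_pos

theorem dz_logJ (h : IsStrictBoundaryPoint r z) (k : Fin n) :
    dz k (toC (logJ r)) z
      = ((bordered r z)⁻¹ * wirtMatrix (-Complex.I) k (bordered r) z).trace := by
  rw [dz_eq_wirt, wirt_congr h.logJ_eventuallyEq]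
  exact wirt_log_neg_det (fun a b => (contDiffAt_bordered h.contDiffAt a b).differentiableAt
    (by simp)) h.neg_det_mem_slitPlane

theorem dz_dzbar_logJ (h : IsStrictBoundaryPoint r z) (k l : Fin n) :
    dz k (dzbar l (toC (logJ r))) z
      = ((bordered r z)⁻¹
          * wirtMatrix (-Complex.I) k (wirtMatrix Complex.I l (bordered r)) z).trace
        - ((bordered r z)⁻¹ * wirtMatrix (-Complex.I) k (bordered r) z * (bordered r z)⁻¹
          * wirtMatrix Complex.I l (bordered r) z).trace := by
  rw [dz_eq_wirt, dzbar_eq_wirt, wirt_congr (wirt_eventuallyEq h.logJ_eventuallyEq)]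
  exact wirt_wirt_log_neg_det (contDiffAt_bordered h.contDiffAt) h.neg_det_mem_slitPlane

/-! Symmetries of the higher derivatives. -/

theorem wirt_wirt_comm (h : IsStrictBoundaryPoint r z) (a b c : ℂ) (i j k : Fin n) :
    wirt a i (wirt b j (wirt c k (toC r))) z = wirt a i (wirt c k (wirt b j (toC r))) z :=
  wirt_congr (wirt_comm_eventuallyEq (m := 4) (by norm_num) h.contDiffAt)

theorem wirt_comm_wirt (h : IsStrictBoundaryPoint r z) (a b c : ℂ) (i j k : Fin n) :
    wirt a i (wirt b j (wirt c k (toC r))) z = wirt b j (wirt a i (wirt c k (toC r))) z :=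
  wirt_comm ((contDiffAt_wirt (m := 3) h.contDiffAt).of_le (by norm_num))

theorem dz_dzbar_dz (h : IsStrictBoundaryPoint r z) (i j k : Fin n) :
    dz i (dzbar j (dz k (toC r))) z = r3 r z i j k := by
  simp only [r3, dz_eq_wirt, dzbar_eq_wirt]
  rw [h.wirt_wirt_comm, h.wirt_comm_wirt]

theorem dz_dzbar_dz' (h : IsStrictBoundaryPoint r z) (k l i : Fin n) :
    dz k (dzbar l (dz i (toC r))) z = r3 r z i l k := by
  simp only [r3, dz_eq_wirt, dzbar_eq_wirt]
  rw [h.wirt_wirt_comm]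

theorem dz_dzbar_dzbar (h : IsStrictBoundaryPoint r z) (i j l : Fin n) :
    dz i (dzbar j (dzbar l (toC r))) z = r3bar r z i j l := by
  simp only [r3bar, dz_eq_wirt, dzbar_eq_wirt]
  rw [h.wirt_wirt_comm, h.wirt_comm_wirt]

theorem dz_dzbar_dzbar' (h : IsStrictBoundaryPoint r z) (k l j : Fin n) :
    dz k (dzbar l (dzbar j (toC r))) z = r3bar r z k j l := by
  simp only [r3bar, dz_eq_wirt, dzbar_eq_wirt]
  rw [h.wirt_comm_wirt]

theorem r4_symm (h : IsStrictBoundaryPoint r z) (i j k l : Fin n) :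
    dz k (dzbar l (dz i (dzbar j (toC r)))) z = dz i (dzbar j (dz k (dzbar l (toC r)))) z := by
  have h3 : ∀ ε s, ContDiffAt ℝ (3 : ℕ) (wirt ε s (toC r)) z := fun ε s =>
    contDiffAt_wirt h.contDiffAt
  have h2 : ∀ ε s δ t, ContDiffAt ℝ (2 : ℕ) (wirt ε s (wirt δ t (toC r))) z :=
    fun ε s δ t => contDiffAt_wirt (h3 δ t)
  simp only [dz_eq_wirt, dzbar_eq_wirt]
  rw [wirt_congr (wirt_comm_eventuallyEq (m := 3) (by norm_num) (h3 _ _)),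
    wirt_congr (wirt_eventuallyEq
      (wirt_comm_eventuallyEq (m := 4) (k := j) (by norm_num) h.contDiffAt)),
    wirt_comm (h2 _ _ _ _),
    wirt_congr (wirt_comm_eventuallyEq (m := 3) (k := j) (by norm_num) (h3 _ _))]

theorem r3bar_eq (h : IsStrictBoundaryPoint r z) (p q l : Fin n) :
    r3bar r z p q l = star (r3 r z q p l) := by
  simp only [r3, r3bar, star_dz, star_dzbar_toC]
  simp only [dz_eq_wirt, dzbar_eq_wirt]
  rw [h.wirt_wirt_comm]

theorem r2bar_eq (q l : Fin n) : r2bar r z q l = star (r2 r z q l) := by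
  simp only [r2, r2bar, star_dz, star_toC]

end IsStrictBoundaryPoint

/-! ### Contraction of Hermitian-type index expressions with a direction. -/

section Contraction

variable (v : Fin n → ℂ)

/-- The sesquilinear contraction `∑ F_{k l̄} v_k v̄_l`. -/
def contract (F : Fin n → Fin n → ℂ) : ℂ := ∑ k, ∑ l, v k * star (v l) * F k l

theorem contract_sum {ι : Type*} (s : Finset ι) (F : ι → Fin n → Fin n → ℂ) :
    contract v (fun k l => ∑ i ∈ s, F i k l) = ∑ i ∈ s, contract v (F i) := by
  simp only [contract, Finset.mul_sum]
  rw [Finset.sum_comm]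
  simp_rw [Finset.sum_comm (s := s)]
  rw [Finset.sum_comm]

theorem contract_mul_left (c : ℂ) (F : Fin n → Fin n → ℂ) :
    contract v (fun k l => c * F k l) = c * contract v F := by
  simp only [contract, Finset.mul_sum]
  exact Finset.sum_congr rfl fun k _ => Finset.sum_congr rfl fun l _ => by ring

theorem contract_add (F G : Fin n → Fin n → ℂ) :
    contract v (fun k l => F k l + G k l) = contract v F + contract v G := by
  simp only [contract, mul_add, Finset.sum_add_distrib]

theorem contract_sub (F G : Fin n → Fin n → ℂ) :
    contract v (fun k l => F k l - G k l) = contract v F - contract v G := by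
  simp only [contract, mul_sub, Finset.sum_sub_distrib]

theorem contract_div (c : ℂ) (F : Fin n → Fin n → ℂ) :
    contract v (fun k l => F k l / c) = c⁻¹ * contract v F := by
  simp only [div_eq_inv_mul, contract_mul_left]

theorem contract_mul (x y : Fin n → ℂ) :
    contract v (fun k l => x k * y l) = (∑ k, v k * x k) * ∑ l, star (v l) * y l := by
  rw [contract, Finset.sum_mul_sum]
  exact Finset.sum_congr rfl fun k _ => Finset.sum_congr rfl fun l _ => by ring

theorem contract_mul_star (x : Fin n → ℂ) :
    contract v (fun k l => x k * star (x l)) = (Complex.normSq (∑ k, v k * x k) : ℂ) := by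
  rw [contract_mul, ← Complex.mul_conj]
  simp [map_sum]

theorem contract_trace {ι : Type*} [Fintype ι] (P : Matrix ι ι ℂ)
    (X : Fin n → Fin n → Matrix ι ι ℂ) (Y Z : Fin n → Matrix ι ι ℂ) :
    contract v (fun k l => (P * X k l).trace - (P * Y k * P * Z l).trace)
      = (P * ∑ k, ∑ l, (v k * star (v l)) • X k l).trace
        - (P * (∑ k, v k • Y k) * P * ∑ l, star (v l) • Z l).trace := by
  rw [contract_sub]
  congr 1
  · simp only [contract, Matrix.mul_sum, Matrix.trace_sum, Matrix.mul_smul, Matrix.trace_smul,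
      smul_eq_mul]
  · simp only [contract, Matrix.sum_mul, Matrix.trace_sum, Matrix.mul_smul,
      Matrix.smul_mul, Matrix.trace_smul, smul_eq_mul, Finset.mul_sum]
    rw [Finset.sum_comm]
    exact Finset.sum_congr rfl fun k _ => Finset.sum_congr rfl fun l _ => by ring

/-- This splits the trace against `a^{k l̄}` into one contraction per row of `B`, reducing the
theorem to single directions. -/
theorem sum_mul_eq_sum_contract {A B : Matrix (Fin n) (Fin n) ℂ} (hB : A = Bᴴ * B)
    (F : Fin n → Fin n → ℂ) :
    ∑ k, ∑ l, A l k * F k l = ∑ m, contract (B m) F := by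
  simp only [hB, Matrix.mul_apply, conjTranspose_apply, Finset.sum_mul, contract]
  symm
  rw [Finset.sum_comm]
  refine Finset.sum_congr rfl fun k _ => ?_
  rw [Finset.sum_comm]
  exact Finset.sum_congr rfl fun l _ => Finset.sum_congr rfl fun m _ => by ring

end Contraction

theorem trace_unit (X : Matrix Unit Unit ℂ) : X.trace = X () () := by
  simp [Matrix.trace]

theorem trace_conj_col {ι : Type*} [Fintype ι] (A : Matrix ι ι ℂ) (Y : Matrix ι Unit ℂ) :
    (Yᴴ * A * Y).trace = ∑ i, ∑ q, A q i * Y i () * star (Y q ()) := by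
  rw [trace_unit]
  simp only [Matrix.mul_apply, conjTranspose_apply, Finset.sum_mul]
  exact Finset.sum_congr rfl fun i _ => Finset.sum_congr rfl fun q _ => by ring

/-! ### Derivatives of the border and the Hessian along a direction. -/

section Direction

variable (r : (Fin n → ℂ) → ℝ) (z : Fin n → ℂ) (v : Fin n → ℂ)

/-- The row vector `v`. -/
def dirRow : Matrix Unit (Fin n) ℂ := Matrix.of fun _ k => v k

/-- The column `∑_k v_k r_{i k}`. -/
def dirCol : Matrix (Fin n) Unit ℂ := Matrix.of fun i _ => ∑ k, v k * r2 r z i k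

/-- The derivative `∑_k v_k r_{i j̄ k}` of the complex Hessian. -/
def dirHess : Matrix (Fin n) (Fin n) ℂ := Matrix.of fun i j => ∑ k, v k * r3 r z i j k

/-- The second derivative `∑_{k,l} v_k v̄_l r_{i j̄ k l̄}` of the complex Hessian. -/
def dirHess₂ : Matrix (Fin n) (Fin n) ℂ :=
  Matrix.of fun i j => contract v fun k l => dz i (dzbar j (dz k (dzbar l (toC r)))) z

end Direction

/-! ### Tangential derivatives of `log J(r)` and the two inequalities in one direction. -/

namespace IsStrictBoundaryPoint

open scoped ComplexOrder

variable {r : (Fin n → ℂ) → ℝ} {z : Fin n → ℂ} {v : Fin n → ℂ}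

/-- Tangency is what makes the corner entry `∑ v_k r_k` vanish. -/
theorem sum_wirtMatrix_dz (hv : dirRow v * gradCol r z = 0) :
    ∑ k, v k • wirtMatrix (-Complex.I) k (bordered r) z
      = fromBlocks 0 (dirRow v * hess r z) (dirCol r z v) (dirHess r z v) := by
  ext a b
  rw [Matrix.sum_apply]
  rcases a with a | i <;> rcases b with b | j
  · simpa [Matrix.mul_apply, dirRow, gradCol, wirtMatrix, bordered, dz_eq_wirt] using
      congrFun (congrFun hv a) b
  · simp [Matrix.mul_apply, dirRow, wirtMatrix, bordered, hess, dz_eq_wirt]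
  · simp [dirCol, wirtMatrix, bordered, r2, dz_eq_wirt]
  · simp [dirHess, wirtMatrix, bordered, hess, r3, dz_eq_wirt]

theorem sum_wirtMatrix_dzbar (h : IsStrictBoundaryPoint r z) (hv : dirRow v * gradCol r z = 0) :
    ∑ k, star (v k) • wirtMatrix Complex.I k (bordered r) z
      = fromBlocks 0 (dirCol r z v)ᴴ (hess r z * (dirRow v)ᴴ) (dirHess r z v)ᴴ := by
  ext a b
  rw [Matrix.sum_apply]
  rcases a with a | i <;> rcases b with b | j
  · have := congrArg star (congrFun (congrFun hv a) b)
    simp only [Matrix.mul_apply, star_sum, star_mul', dirRow, gradCol, Matrix.of_apply,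
      star_dz_toC, Matrix.zero_apply, star_zero] at this
    simpa [wirtMatrix, bordered, dzbar_eq_wirt] using this
  · simp only [fromBlocks_apply₁₂, conjTranspose_apply, dirCol, Matrix.of_apply, star_sum,
      star_mul', ← r2bar_eq, r2bar, Matrix.smul_apply, wirtMatrix, bordered, dzbar_eq_wirt,
      smul_eq_mul]
  · simp only [fromBlocks_apply₂₁, Matrix.mul_apply, conjTranspose_apply, dirRow, Matrix.of_apply,
      Matrix.smul_apply, wirtMatrix, bordered, hess, smul_eq_mul, dz_eq_wirt, dzbar_eq_wirt]
    refine Finset.sum_congr rfl fun k _ => ?_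
    rw [mul_comm, wirt_comm (h.contDiffAt.of_le (by norm_num))]
  · simp only [fromBlocks_apply₂₂, conjTranspose_apply, dirHess, Matrix.of_apply, star_sum,
      star_mul', ← h.r3bar_eq, r3bar, Matrix.smul_apply, wirtMatrix, bordered, hess,
      dzbar_eq_wirt, smul_eq_mul]

theorem sum_wirtMatrix_dz_dzbar (h : IsStrictBoundaryPoint r z) :
    ∑ k, ∑ l, (v k * star (v l)) • wirtMatrix (-Complex.I) k (wirtMatrix Complex.I l (bordered r)) z
      = fromBlocks (dirRow v * hess r z * (dirRow v)ᴴ) (dirRow v * (dirHess r z v)ᴴ)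
        (dirHess r z v * (dirRow v)ᴴ) (dirHess₂ r z v) := by
  ext a b
  simp only [Matrix.sum_apply, Matrix.smul_apply, wirtMatrix, Matrix.of_apply, smul_eq_mul]
  rcases a with a | i <;> rcases b with b | j
  · simp only [fromBlocks_apply₁₁, Matrix.mul_apply, conjTranspose_apply, dirRow, Matrix.of_apply,
      bordered, hess, dz_eq_wirt, dzbar_eq_wirt, Finset.sum_mul]
    rw [Finset.sum_comm]
    exact Finset.sum_congr rfl fun k _ => Finset.sum_congr rfl fun l _ => by
      rw [mul_right_comm]
  · simp only [fromBlocks_apply₁₂, Matrix.mul_apply, conjTranspose_apply, dirRow, Matrix.of_apply,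
      bordered, dirHess, star_sum, star_mul', ← h.r3bar_eq, Finset.mul_sum,
      ← h.dz_dzbar_dzbar' _ _ j]
    simp only [dz_eq_wirt, dzbar_eq_wirt, mul_assoc]
  · simp only [fromBlocks_apply₂₁, Matrix.mul_apply, conjTranspose_apply, dirRow, Matrix.of_apply,
      bordered, dirHess, Finset.sum_mul, ← h.dz_dzbar_dz' _ _ i]
    rw [Finset.sum_comm]
    simp only [dz_eq_wirt, dzbar_eq_wirt, mul_right_comm]
  · simp only [fromBlocks_apply₂₂, dirHess₂, contract, Matrix.of_apply, bordered, hess,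
      ← h.r4_symm i j]
    simp only [dz_eq_wirt, dzbar_eq_wirt]

/-- The Levi form of `log J(r)` in a complex tangential direction. -/
theorem contract_dz_dzbar_logJ (h : IsStrictBoundaryPoint r z)
    (hv : dirRow v * gradCol r z = 0) :
    contract v (fun k l => dz k (dzbar l (toC (logJ r))) z)
      = (tangentialInv (hess r z) (gradCol r z) (gradSq r z) * dirHess₂ r z v).trace
        + (gradSq r z : ℂ)⁻¹ *
          ((dirCol r z v - dirHess r z v * ((hess r z)⁻¹ * gradCol r z))ᴴ
            * tangentialInv (hess r z) (gradCol r z) (gradSq r z)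
            * (dirCol r z v - dirHess r z v * ((hess r z)⁻¹ * gradCol r z))).trace
        - ((hess r z)⁻¹ * (dirHess r z v)ᴴ * tangentialInv (hess r z) (gradCol r z) (gradSq r z)
            * dirHess r z v).trace := by
  simp only [h.dz_dzbar_logJ]
  rw [contract_trace, sum_wirtMatrix_dz hv, h.sum_wirtMatrix_dzbar hv, h.sum_wirtMatrix_dz_dzbar,
    h.bordered_eq]
  exact trace_bordered_eq h.posDef h.gradSq_pos.ne' h.gradCol_form.1 hv _ _ _

theorem sum_lapTilde_dz (h : IsStrictBoundaryPoint r z) :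
    ∑ k, v k * lapTilde r (dz k (toC r)) z
      = (tangentialInv (hess r z) (gradCol r z) (gradSq r z) * dirHess r z v).trace := by
  simp only [lapTilde, h.dz_dzbar_dz, h.aUp_eq, Matrix.trace, Matrix.diag_apply, Matrix.mul_apply,
    dirHess, Matrix.of_apply, Finset.mul_sum]
  rw [Finset.sum_comm, Finset.sum_comm (s := Finset.univ) (t := Finset.univ)
    (f := fun i j => ∑ k, tangentialInv (hess r z) (gradCol r z) (gradSq r z) i j * _)]
  refine Finset.sum_congr rfl fun i _ => ?_
  rw [Finset.sum_comm]
  exact Finset.sum_congr rfl fun j _ => Finset.sum_congr rfl fun k _ => mul_left_comm _ _ _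

/-- Two block traces survive, `tr(A R)` and `g⁻¹ uᴴ H⁻¹ ξ`; the remaining border term is a multiple
of `v · u = 0`. -/
theorem sum_dz_logJ (h : IsStrictBoundaryPoint r z) (hv : dirRow v * gradCol r z = 0) :
    ∑ k, v k * dz k (toC (logJ r)) z
      = ∑ k, v k * lapTilde r (dz k (toC r)) z
        + (gradSq r z : ℂ)⁻¹ * ∑ k, v k * ∑ i, rUp r z i * r2 r z i k := by
  have hdet : IsUnit (hess r z).det := (Matrix.isUnit_iff_isUnit_det _).1 h.posDef.isUnit
  have h1 : ∑ k, v k * dz k (toC (logJ r)) z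
      = ((bordered r z)⁻¹ * ∑ k, v k • wirtMatrix (-Complex.I) k (bordered r) z).trace := by
    simp only [h.dz_logJ, Matrix.mul_sum, Matrix.trace_sum, Matrix.mul_smul, Matrix.trace_smul,
      smul_eq_mul]
  have h2 : ∑ k, v k * ∑ i, rUp r z i * r2 r z i k
      = ((gradCol r z)ᴴ * (hess r z)⁻¹ * dirCol r z v).trace := by
    rw [trace_unit, Matrix.mul_apply]
    simp only [← rUp_eq, dirCol, Matrix.of_apply, Finset.mul_sum]
    rw [Finset.sum_comm]
    exact Finset.sum_congr rfl fun j _ => Finset.sum_congr rfl fun k _ => mul_left_comm _ _ _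
  rw [h1, h2, sum_wirtMatrix_dz hv, h.bordered_eq,
    Matrix.inv_eq_right_inv (bordered_mul_inv hdet h.gradSq_pos.ne' h.gradCol_form.1),
    fromBlocks_multiply, trace_fromBlocks_unit, h.sum_lapTilde_dz, Matrix.trace_add, Matrix.trace_add]
  have h3 : (((gradSq r z : ℂ)⁻¹ • ((hess r z)⁻¹ * gradCol r z))
      * (dirRow v * hess r z)).trace = 0 := by
    rw [Matrix.trace_mul_comm, Matrix.mul_smul, Matrix.mul_assoc,
      Matrix.mul_nonsing_inv_cancel_left _ _ hdet, hv, smul_zero, Matrix.trace_zero]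
  rw [h3, Matrix.mul_zero, zero_add, Matrix.smul_mul, Matrix.trace_smul, smul_eq_mul,
    Matrix.trace_zero, zero_add, add_comm]

theorem contract_lapTilde (h : IsStrictBoundaryPoint r z) :
    contract v (fun k l => lapTilde r (dz k (dzbar l (toC r))) z)
      = (tangentialInv (hess r z) (gradCol r z) (gradSq r z) * dirHess₂ r z v).trace := by
  simp only [lapTilde, contract_sum, contract_mul_left, h.aUp_eq, Matrix.trace, Matrix.diag_apply,
    Matrix.mul_apply, dirHess₂, Matrix.of_apply]
  rw [Finset.sum_comm]

theorem contract_r3 (h : IsStrictBoundaryPoint r z) (c : ℂ) (i j p q : Fin n) :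
    contract v (fun k l => c * r3 r z i j k * r3bar r z p q l)
      = c * dirHess r z v i j * star (dirHess r z v q p) := by
  simp only [mul_assoc, contract_mul_left, contract_mul, dirHess, Matrix.of_apply, star_sum,
    star_mul', h.r3bar_eq]

theorem contract_r2 (c : ℂ) (i q : Fin n) :
    contract v (fun k l => c * r2 r z i k * r2bar r z q l)
      = c * dirCol r z v i () * star (dirCol r z v q ()) := by
  simp only [mul_assoc, contract_mul_left, contract_mul, dirCol, Matrix.of_apply, star_sum,
    star_mul', r2bar_eq]

theorem contract_rInv (h : IsStrictBoundaryPoint r z) :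
    contract v (fun k l => ∑ i, ∑ q, ∑ p, ∑ j,
        aUp r z i q * rInv r z p j * r3 r z i j k * r3bar r z p q l)
      = ((hess r z)⁻¹ * (dirHess r z v)ᴴ * tangentialInv (hess r z) (gradCol r z) (gradSq r z)
            * dirHess r z v).trace := by
  simp only [contract_sum, h.contract_r3, h.aUp_eq, rInv, Matrix.trace, Matrix.diag_apply,
    Matrix.mul_apply, conjTranspose_apply, Finset.sum_mul]
  symm
  rw [Finset.sum_comm]
  refine Finset.sum_congr rfl fun i _ => ?_
  rw [Finset.sum_comm]
  refine Finset.sum_congr rfl fun q _ => ?_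
  rw [Finset.sum_comm]
  exact Finset.sum_congr rfl fun p _ => Finset.sum_congr rfl fun j _ => by ring

theorem star_rUpBar (h : IsStrictBoundaryPoint r z) (j : Fin n) :
    star (rUpBar r z j) = rUp r z j := by
  have hi : (hess r z)⁻¹ᴴ = (hess r z)⁻¹ := h.posDef.isHermitian.inv
  rw [rUpBar_eq, rUp_eq, ← conjTranspose_apply, Matrix.conjTranspose_mul, hi]

theorem contract_rUp (h : IsStrictBoundaryPoint r z) :
    contract v (fun k l => ∑ i, ∑ q, ∑ p, ∑ j,
        aUp r z i q * rUp r z p * rUpBar r z j * r3 r z i j k * r3bar r z p q l)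
      = ((dirHess r z v * ((hess r z)⁻¹ * gradCol r z))ᴴ
            * tangentialInv (hess r z) (gradCol r z) (gradSq r z)
            * (dirHess r z v * ((hess r z)⁻¹ * gradCol r z))).trace := by
  have hY : ∀ i, (dirHess r z v * ((hess r z)⁻¹ * gradCol r z)) i ()
      = ∑ j, dirHess r z v i j * rUpBar r z j := fun i => by
    rw [Matrix.mul_apply]
    simp only [rUpBar_eq]
  rw [trace_conj_col]
  simp only [contract_sum, h.contract_r3, h.aUp_eq, hY, star_sum, star_mul', h.star_rUpBar]
  refine Finset.sum_congr rfl fun i _ => Finset.sum_congr rfl fun q _ => ?_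
  rw [mul_assoc, Finset.sum_mul_sum, Finset.sum_comm, Finset.mul_sum]
  refine Finset.sum_congr rfl fun j _ => ?_
  rw [Finset.mul_sum]
  exact Finset.sum_congr rfl fun p _ => by ring

theorem contract_r2_r2bar (h : IsStrictBoundaryPoint r z) :
    contract v (fun k l => ∑ i, ∑ q, aUp r z i q * r2 r z i k * r2bar r z q l)
      = ((dirCol r z v)ᴴ * tangentialInv (hess r z) (gradCol r z) (gradSq r z)
            * dirCol r z v).trace := by
  simp only [contract_sum, contract_r2, h.aUp_eq, trace_conj_col]

theorem star_lapTilde_dz (h : IsStrictBoundaryPoint r z) (l : Fin n) :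
    lapTilde r (dzbar l (toC r)) z = star (lapTilde r (dz l (toC r)) z) := by
  have hA : ∀ i j, star (aUp r z i j) = aUp r z j i := fun i j => by
    rw [h.aUp_eq, h.aUp_eq]
    exact (tangentialInv_isHermitian h.posDef.isHermitian).apply _ _
  simp only [lapTilde, h.dz_dzbar_dz, h.dz_dzbar_dzbar, star_sum, star_mul', hA, h.r3bar_eq]
  rw [Finset.sum_comm]

theorem contract_logJ (h : IsStrictBoundaryPoint r z) (hv : dirRow v * gradCol r z = 0) :
    contract v (fun k l => dz k (toC (logJ r)) z * dzbar l (toC (logJ r)) z)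
      = (Complex.normSq (∑ k, v k * lapTilde r (dz k (toC r)) z
        + (gradSq r z : ℂ)⁻¹ * ∑ k, v k * ∑ i, rUp r z i * r2 r z i k) : ℂ) := by
  simp only [← star_dz_toC]
  rw [contract_mul_star, h.sum_dz_logJ hv]

theorem contract_lower (h : IsStrictBoundaryPoint r z) (hn : 0 < n)
    (hv : dirRow v * gradCol r z = 0) :
    (contract v fun k l => lapTilde r (dz k (dzbar l (toC r))) z
            - (∑ i, ∑ q, ∑ p, ∑ j,
                aUp r z i q * rInv r z p j * r3 r z i j k * r3bar r z p q l)
            - lapTilde r (dz k (toC r)) z * lapTilde r (dzbar l (toC r)) z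
            - n * ((∑ i, rUp r z i * r2 r z i k) * (∑ j, rUpBar r z j * r2bar r z j l))
                / (gradSq r z : ℂ) ^ 2).re
      ≤ (contract v fun k l => dz k (dzbar l (toC (logJ r))) z).re
        - n / (n + 1)
          * (contract v fun k l => dz k (toC (logJ r)) z * dzbar l (toC (logJ r)) z).re := by
  have hg := h.gradSq_pos
  have hn' : (0 : ℝ) < n := by exact_mod_cast hn
  have hs : ∀ l, ∑ j, rUpBar r z j * r2bar r z j l = star (∑ i, rUp r z i * r2 r z i l) := by
    intro l
    simp only [star_sum, star_mul', r2bar_eq, ← h.star_rUpBar, star_star]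
  simp only [contract_sub, contract_div, contract_mul_left, hs, h.star_lapTilde_dz,
    contract_mul_star, h.contract_lapTilde, h.contract_rInv, h.contract_dz_dzbar_logJ hv,
    h.contract_logJ hv]
  have hA := tangentialInv_posSemidef h.posDef hg.ne' h.gradCol_form.1
  have h0 := re_trace_conj_nonneg hA
    (dirCol r z v - dirHess r z v * ((hess r z)⁻¹ * gradCol r z))
  generalize ∑ k, v k * lapTilde r (dz k (toC r)) z = P
  generalize ∑ k, v k * ∑ i, rUp r z i * r2 r z i k = Q
  generalize gradSq r z = g at *
  rw [show ((g : ℂ) ^ 2)⁻¹ * ((n : ℂ) * (Complex.normSq Q : ℂ))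
      = (((g ^ 2)⁻¹ * (n * Complex.normSq Q) : ℝ) : ℂ) by push_cast; ring]
  rw [← Complex.ofReal_inv]
  simp only [Complex.sub_re, Complex.add_re, Complex.ofReal_re, Complex.re_ofReal_mul]
  have h1 : 0 ≤ g⁻¹ * ((dirCol r z v - dirHess r z v * ((hess r z)⁻¹ * gradCol r z))ᴴ
      * tangentialInv (hess r z) (gradCol r z) g
      * (dirCol r z v - dirHess r z v * ((hess r z)⁻¹ * gradCol r z))).trace.re :=
    mul_nonneg (inv_nonneg.2 hg.le) h0
  -- Weighted Cauchy–Schwarz; the weight `n/(n+1)` makes the defect the exact square `|P - n g⁻¹ Q|²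
  -- / (n+1)`.
  have h2 : (n : ℝ) / (n + 1) * Complex.normSq (P + ((g⁻¹ : ℝ) : ℂ) * Q)
      ≤ Complex.normSq P + (g ^ 2)⁻¹ * (n * Complex.normSq Q) := by
    have h3 : Complex.normSq P + (g ^ 2)⁻¹ * (n * Complex.normSq Q)
        - (n : ℝ) / (n + 1) * Complex.normSq (P + ((g⁻¹ : ℝ) : ℂ) * Q)
        = 1 / (n + 1) * Complex.normSq (P - ((n * g⁻¹ : ℝ) : ℂ) * Q) := by
      simp only [Complex.normSq_apply, Complex.add_re, Complex.add_im, Complex.sub_re,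
        Complex.sub_im, Complex.re_ofReal_mul, Complex.im_ofReal_mul]
      field_simp
      ring
    have h4 : 0 ≤ 1 / ((n : ℝ) + 1) * Complex.normSq (P - ((n * g⁻¹ : ℝ) : ℂ) * Q) :=
      mul_nonneg (by positivity) (Complex.normSq_nonneg _)
    linarith
  linarith

theorem contract_upper (h : IsStrictBoundaryPoint r z) (hv : dirRow v * gradCol r z = 0) :
    (contract v fun k l => dz k (dzbar l (toC (logJ r))) z).re
        - n / (n + 1)
          * (contract v fun k l => dz k (toC (logJ r)) z * dzbar l (toC (logJ r)) z).re
      ≤ (contract v fun k l => lapTilde r (dz k (dzbar l (toC r))) z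
            + (∑ i, ∑ q, ∑ p, ∑ j,
                aUp r z i q * rUp r z p * rUpBar r z j * r3 r z i j k * r3bar r z p q l)
                / (gradSq r z : ℂ)
            + 2 * (∑ i, ∑ q, aUp r z i q * r2 r z i k * r2bar r z q l)
                / (gradSq r z : ℂ)).re := by
  have hg := h.gradSq_pos
  simp only [contract_add, contract_div, contract_mul_left, h.contract_lapTilde, h.contract_rUp,
    h.contract_r2_r2bar, h.contract_dz_dzbar_logJ hv, h.contract_logJ hv]
  have hA := tangentialInv_posSemidef h.posDef hg.ne' h.gradCol_form.1
  have h0 := re_trace_conj_nonneg hA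
    (dirCol r z v + dirHess r z v * ((hess r z)⁻¹ * gradCol r z))
  have h1 := re_trace_conj_le h.posDef hg.ne' h.gradCol_form.1 (dirHess r z v)
  have h2 : 0 ≤ (n : ℝ) / (n + 1) * Complex.normSq (∑ k, v k * lapTilde r (dz k (toC r)) z
        + (gradSq r z : ℂ)⁻¹ * ∑ k, v k * ∑ i, rUp r z i * r2 r z i k) :=
    mul_nonneg (by positivity) (Complex.normSq_nonneg _)
  rw [Complex.sub_re, Complex.add_re, Complex.add_re, Complex.add_re, Complex.ofReal_re]
  rw [← Complex.ofReal_inv] at *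
  rw [mul_left_comm, show (2 : ℂ) = ((2 : ℝ) : ℂ) by norm_num]
  simp only [Complex.re_ofReal_mul] at *
  set Y := dirHess r z v * ((hess r z)⁻¹ * gradCol r z)
  set X := dirCol r z v
  set A := tangentialInv (hess r z) (gradCol r z) (gradSq r z)
  -- Parallelogram law for the `A`-seminorm; the square of `X + Y` is then dropped.
  have h3 : ((X - Y)ᴴ * A * (X - Y)).trace.re
      = 2 * (Xᴴ * A * X).trace.re + 2 * (Yᴴ * A * Y).trace.re
        - ((X + Y)ᴴ * A * (X + Y)).trace.re := by
    simp only [Matrix.conjTranspose_sub, Matrix.conjTranspose_add, Matrix.sub_mul, Matrix.mul_sub,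
      Matrix.add_mul, Matrix.mul_add, Matrix.trace_sub, Matrix.trace_add, Complex.sub_re,
      Complex.add_re]
    ring
  have h4 := mul_nonneg (inv_nonneg.2 hg.le) h0
  rw [h3, mul_sub, mul_add]
  linarith

end IsStrictBoundaryPoint

/-! ### From the domain to a boundary point, and summation over the tangential frame. -/

theorem isStrictBoundaryPoint_of_mem_frontier {D : Set (Fin n → ℂ)} (hDo : IsOpen D)
    {r : (Fin n → ℂ) → ℝ} (hr : IsDefiningFunction 4 D r) (hpsh : StrictlyPSHOn r (frontier D))
    {z : Fin n → ℂ} (hz : z ∈ frontier D) : IsStrictBoundaryPoint r z := by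
  obtain ⟨U, hU, hDU, hrU, hD, hdr⟩ := hr
  have hzU : z ∈ U := hDU (frontier_subset_closure hz)
  have hrz : ContDiffAt ℝ (4 : ℕ) r z := hrU.contDiffAt (hU.mem_nhds hzU)
  have hzD : z ∉ D := by
    rw [hDo.frontier_eq] at hz
    exact hz.2
  refine ⟨Complex.ofRealCLM.contDiff.contDiffAt.comp z hrz, le_antisymm ?_ ?_,
    gradCol_ne_zero (hrz.differentiableAt (by simp)) (hdr z hz), hpsh z hz⟩
  -- `r ≤ 0` as a limit of negative values from `D`; if `r < 0`, then `z` would lie in the open set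
  -- `D`, which misses its frontier.
  · have : (𝓝[D] z).NeBot := mem_closure_iff_nhdsWithin_neBot.1 (frontier_subset_closure hz)
    refine le_of_tendsto (hrz.continuousAt.tendsto.mono_left
      (nhdsWithin_le_nhds (s := D))) ?_
    filter_upwards [self_mem_nhdsWithin] with y hy
    rw [hD] at hy
    exact hy.2.le
  · by_contra hlt
    exact hzD (hD ▸ ⟨hzU, not_le.1 hlt⟩)

/-- The prefactor `|∂r|²_r / (n(n+1))` cancels `2n / |∂r|²_r` to `2/(n+1)`, isolating the term
common to both bounds. -/
theorem Etilde_eq {r : (Fin n → ℂ) → ℝ} {z : Fin n → ℂ} (hn : 0 < n) (hg : 0 < gradSq r z) :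
    Etilde r z = gradSq r z / (n * (n + 1)) *
        ((lapTilde r (toC (logJ r)) z).re
          - n / (n + 1) * (gradTildeSq r (toC (logJ r)) z).re)
      - 2 * (∑ k, rUp r z k * lapTilde r (dz k (toC r)) z).re / (n + 1) := by
  have hn' : (n : ℝ) ≠ 0 := by exact_mod_cast hn.ne'
  rw [Etilde, Complex.div_ofReal_re]
  field_simp

end Fefferman

end

open Fefferman in
theorem proposition4p2 {n : ℕ} (D : Set (Fin n → ℂ)) (hDo : IsOpen D) (hDc : IsConnected D)
    (hDb : Bornology.IsBounded D) (r : (Fin n → ℂ) → ℝ) (hr : IsDefiningFunction 4 D r)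
    (hpsh : StrictlyPSHOn r (frontier D)) (z : Fin n → ℂ) (hz : z ∈ frontier D) :
    (gradSq r z / (n * (n + 1)) *
        (∑ k, ∑ l, aUp r z k l *
          (lapTilde r (dz k (dzbar l (toC r))) z
            - (∑ i, ∑ q, ∑ p, ∑ j,
                aUp r z i q * rInv r z p j * r3 r z i j k * r3bar r z p q l)
            - lapTilde r (dz k (toC r)) z * lapTilde r (dzbar l (toC r)) z
            - n * ((∑ i, rUp r z i * r2 r z i k) * (∑ j, rUpBar r z j * r2bar r z j l))
                / (gradSq r z : ℂ) ^ 2)).re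
      - 2 * (∑ k, rUp r z k * lapTilde r (dz k (toC r)) z).re / (n + 1)
      ≤ Etilde r z) ∧
    (Etilde r z ≤
      gradSq r z / (n * (n + 1)) *
        (∑ k, ∑ l, aUp r z k l *
          (lapTilde r (dz k (dzbar l (toC r))) z
            + (∑ i, ∑ q, ∑ p, ∑ j,
                aUp r z i q * rUp r z p * rUpBar r z j * r3 r z i j k * r3bar r z p q l)
                / (gradSq r z : ℂ)
            + 2 * (∑ i, ∑ q, aUp r z i q * r2 r z i k * r2bar r z q l)
                / (gradSq r z : ℂ))).re
      - 2 * (∑ k, rUp r z k * lapTilde r (dz k (toC r)) z).re / (n + 1)) := by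
  have h := isStrictBoundaryPoint_of_mem_frontier hDo hr hpsh hz
  have hg := h.gradSq_pos
  have hn : 0 < n := by
    -- In dimension zero the gradient column is empty, hence zero, so there is no such boundary
    -- point.
    rcases Nat.eq_zero_or_pos n with rfl | hn
    · exact absurd (Subsingleton.elim _ _) h.grad_ne_zero
    · exact hn
  have hn' : (0 : ℝ) < n := by exact_mod_cast hn
  have hc : 0 ≤ gradSq r z / (n * (n + 1)) := by positivity
  obtain ⟨B, hB, hBu⟩ := exists_tangential_frame h.posDef hg.ne' h.gradCol_form.1
  have hv : ∀ m, dirRow (B m) * gradCol r z = 0 := fun m => by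
    ext a b
    exact congrFun (congrFun hBu m) b
  have key : (lapTilde r (toC (logJ r)) z).re
      - n / (n + 1) * (gradTildeSq r (toC (logJ r)) z).re
      = ∑ m, ((contract (B m) fun k l => dz k (dzbar l (toC (logJ r))) z).re
        - n / (n + 1) * (contract (B m) fun k l =>
          dz k (toC (logJ r)) z * dzbar l (toC (logJ r)) z).re) := by
    simp only [lapTilde, gradTildeSq, h.aUp_eq, mul_assoc]
    rw [sum_mul_eq_sum_contract hB, sum_mul_eq_sum_contract hB, Complex.re_sum, Complex.re_sum,
      Finset.mul_sum, ← Finset.sum_sub_distrib]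
  have hsum : ∀ F : Fin n → Fin n → ℂ,
      (∑ k, ∑ l, aUp r z k l * F k l).re = ∑ m, (contract (B m) F).re := fun F => by
    simp only [h.aUp_eq]
    rw [sum_mul_eq_sum_contract hB, Complex.re_sum]
  rw [Etilde_eq hn hg, key, hsum, hsum]
  exact ⟨sub_le_sub_right (mul_le_mul_of_nonneg_left
      (Finset.sum_le_sum fun m _ => h.contract_lower hn (hv m)) hc) _,
    sub_le_sub_right (mul_le_mul_of_nonneg_left
      (Finset.sum_le_sum fun m _ => h.contract_upper (hv m)) hc) _⟩
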